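/- For a unital $C^*$-algebra $B$ let $T(B)$ be the set of tracial states of $B$ (positive linear functionals $\tau$ with $\tau(1)=1$ and $\tau(ab)=\tau(ba)$), with the weak* topology. Let $\{A_\beta\}_{\beta<\aleph_1}$ be an increasing sequence, indexed by the countable ordinals, of unital $C^*$-algebras (with unital inclusions) which is continuous, i.e. $A_\gamma=\overline{\bigcup_{\beta<\gamma}A_\beta}$ for every limit ordinal $\gamma<\aleph_1$, and let $A=\overline{\bigcup_{\beta<\aleph_1}A_\beta}$ be its inductive limit. Suppose that for every $\beta<\aleph_1$ there are a discrete group $G_\beta$ and an action $\alpha^\beta\colon G_\beta\to\mathrm{Aut}(A_\beta)$ with $A_{\beta+1}=A_\beta\rtimes_{\alpha^\beta,r}G_\beta$ (the reduced crossed product, containing $A_\beta$ canonically), and that every $\tau\in T(A_\beta)$ satisfies $\tau\circ\alpha^\beta_g=\tau$ for all $g\in G_\beta$. For $g\in G_\beta$ let $u_g\in A_{\beta+1}$ be the corresponding unitary. Then for each $\beta<\aleph_1$ there is a canonical conditional expectation $E_\beta\colon A_{\beta+1}\to A_\beta$, that is, a contractive linear map with $E_\beta(a)=a$ and $E_\beta(au_g)=0$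 for all $a\in A_\beta$ and $g\in G_\beta\setminus\{e\}$, and for each $\beta<\aleph_1$ there is a topological embedding (a homeomorphism onto its image) $e_\beta\colon T(A_\beta)\to T(A)$ such that for every $\tau\in T(A_\beta)$ one has $e_\beta(\tau)|_{A_\beta}=\tau$ and, for every $\gamma$ with $\beta\le\gamma<\aleph_1$, $$e_\beta(\tau)|_{A_{\gamma+1}}=e_\beta(\tau)|_{A_\gamma}\circ E_\gamma .$$ -/

import Mathlib

open scoped ComplexOrder Ordinal

/-- The trace space `T(A)` of a unital C⋆-algebra: the tracial states of `A`,
with the weak-⋆ topology (inherited from `WeakDual ℂ A`). -/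
def traceSpace (A : Type*) [CStarAlgebra A] : Set (WeakDual ℂ A) :=
  {τ | τ 1 = 1 ∧ (∀ a : A, 0 ≤ τ (star a * a)) ∧ ∀ a b : A, τ (a * b) = τ (b * a)}

universe u v w x

section ReducedCrossedProduct

variable {G : Type v} [Group G]

/-- The Hilbert space `ℓ²(G, H)`. -/
abbrev ellTwo (G : Type v) (H : Type w) [NormedAddCommGroup H] : Type (max v w) :=
  lp (fun _ : G => H) 2

/-- The vector `h ↦ ξ(g⁻¹ h)` of `ℓ²(G, H)`. -/
noncomputable def leftTranslate {H : Type w} [NormedAddCommGroup H] (g : G) (ξ : ellTwo G H) :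
    ellTwo G H :=
  ⟨fun h => ξ (g⁻¹ * h), by
    have h2 : 0 < (2 : ENNReal).toReal := by norm_num
    exact memℓp_gen (((lp.memℓp ξ).summable h2).comp_injective (mul_right_injective g⁻¹))⟩

theorem norm_leftTranslate {H : Type w} [NormedAddCommGroup H] (g : G) (ξ : ellTwo G H) :
    ‖leftTranslate g ξ‖ = ‖ξ‖ := by
  have h2 : 0 < (2 : ENNReal).toReal := by norm_num
  rw [lp.norm_eq_tsum_rpow h2, lp.norm_eq_tsum_rpow h2]
  congr 1
  exact (Equiv.mulLeft g⁻¹).tsum_eq (fun h => ‖ξ h‖ ^ (2 : ENNReal).toReal)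

/-- The left translation `(λ_g ξ)(h) = ξ(g⁻¹ h)` on `ℓ²(G, H)`. -/
noncomputable def translationOp (H : Type w) [NormedAddCommGroup H] [InnerProductSpace ℂ H]
    (g : G) : ellTwo G H →L[ℂ] ellTwo G H :=
  LinearMap.mkContinuous
    { toFun := leftTranslate g
      map_add' := fun _ _ => rfl
      map_smul' := fun _ _ => rfl } 1 fun ξ => by
    rw [one_mul]; exact (norm_leftTranslate g ξ).le

variable {B : Type u} [CStarAlgebra B]
  {H : Type w} [NormedAddCommGroup H] [InnerProductSpace ℂ H] [CompleteSpace H]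

/-- The operator `(π̃(b) ξ)(g) = π(α_{g⁻¹}(b)) ξ(g)` on `ℓ²(G, H)`. -/
noncomputable def coeffOp (π : B →⋆ₐ[ℂ] (H →L[ℂ] H)) (α : G →* (B ≃⋆ₐ[ℂ] B)) (b : B) :
    ellTwo G H →L[ℂ] ellTwo G H :=
  lp.mapCLM 2 (fun g : G => π (α g⁻¹ b)) (K := ‖b‖) (norm_nonneg b) fun g =>
    (NonUnitalStarAlgHom.norm_apply_le π (α g⁻¹ b)).trans
      (NonUnitalStarAlgHom.norm_apply_le (α g⁻¹) b)

/-- The reduced crossed product `B ⋊_{α,r} G`, realised on `ℓ²(G, H)` by the representation `π`: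
the C⋆-algebra generated by the operators `π̃(b)`, `b ∈ B`, and `λ_g`, `g ∈ G`. (For injective `π`
this is the reduced crossed product; it does not depend on `π` up to isomorphism.) -/
noncomputable def reducedCrossedProduct (π : B →⋆ₐ[ℂ] (H →L[ℂ] H)) (α : G →* (B ≃⋆ₐ[ℂ] B)) :
    StarSubalgebra ℂ (ellTwo G H →L[ℂ] ellTwo G H) :=
  (StarAlgebra.adjoin ℂ
    (Set.range (coeffOp π α) ∪ Set.range (translationOp (G := G) H))).topologicalClosure

theorem translationOp_mem (π : B →⋆ₐ[ℂ] (H →L[ℂ] H)) (α : G →* (B ≃⋆ₐ[ℂ] B)) (g : G) :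
    translationOp H g ∈ reducedCrossedProduct π α :=
  StarSubalgebra.le_topologicalClosure _ (StarAlgebra.subset_adjoin ℂ _ (Or.inr ⟨g, rfl⟩))

/-- An identification `C = B ⋊_{α,r} G` of a C⋆-algebra `C`, which contains `B` through `ι`, with
the reduced crossed product of `B` by `α`: a faithful representation `π` of `B` on a Hilbert space
`H` and a ⋆-isomorphism of `C` with the reduced crossed product realised on `ℓ²(G, H)` which
carries `ι b` to `π̃(b)`. -/
structure CrossedProductIdent {C : Type x} [CStarAlgebra C] (ι : B →⋆ₐ[ℂ] C)
    (α : G →* (B ≃⋆ₐ[ℂ] B)) where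
  /-- The Hilbert space on which `B` is represented. -/
  H : Type w
  [normed : NormedAddCommGroup H]
  [inner : InnerProductSpace ℂ H]
  [complete : CompleteSpace H]
  /-- The faithful representation of `B`. -/
  π : B →⋆ₐ[ℂ] (H →L[ℂ] H)
  faithful : Function.Injective π
  /-- The identification. -/
  Φ : C ≃⋆ₐ[ℂ] reducedCrossedProduct π α
  apply_ι : ∀ b : B, (Φ (ι b) : ellTwo G H →L[ℂ] ellTwo G H) = coeffOp π α b

attribute [instance] CrossedProductIdent.normed CrossedProductIdent.inner
  CrossedProductIdent.complete

variable {C : Type x} [CStarAlgebra C] {ι : B →⋆ₐ[ℂ] C} {α : G →* (B ≃⋆ₐ[ℂ] B)}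

/-- The unitary `u_g` of `C = B ⋊_{α,r} G` which corresponds to `g ∈ G`. -/
noncomputable def CrossedProductIdent.u (D : CrossedProductIdent.{u, v, w, x} ι α) (g : G) : C :=
  D.Φ.symm ⟨translationOp D.H g, translationOp_mem D.π α g⟩

/-- `E` is the canonical conditional expectation of `C = B ⋊_{α,r} G` onto `B`: the contractive
linear map with `E(b) = b` for `b ∈ B` and `E(b u_g) = 0` for `g ≠ e`. -/
def CrossedProductIdent.IsExpectation (D : CrossedProductIdent.{u, v, w, x} ι α)
    (E : C →L[ℂ] B) : Prop :=
  (∀ c : C, ‖E c‖ ≤ ‖c‖) ∧ (∀ b : B, E (ι b) = b) ∧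
    ∀ (b : B) (g : G), g ≠ 1 → E (ι b * D.u g) = 0

end ReducedCrossedProduct

/-! Let `V : H → ℓ²(G, H)` be the isometry onto the fibre over `e`. The compression `T ↦ V* T V` is
contractive and positive, sends `π̃(b)` to `π(b)` and kills `π̃(b) λ_g` for `g ≠ e`. Since such
products span a dense subspace and the range of `π` is closed, it induces the expectation `E_β`. An
invariant trace composed with `E_β` is again a trace: traciality need only be tested on elements `a
u_g`.

Along the tower, the `E_γ` with `γ ≥ β` are composed transfinitely into a contraction `F : A → A_β`.
Successor stages compose with `E_γ`; limit stages extend from a dense union, which is possible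
because all maps are contractive and a composite is determined by its one-step behaviour
(`IsIteratedExpectation.congr'`). Then `e_β(τ) = τ ∘ F`. It is a trace by transfinite induction
(`comp_limit_expectation_mem_traceSpace`), and `e_β` is an embedding because restriction to `A_β` is
a continuous left inverse. -/

section ReducedCrossedProduct

variable {G : Type v} [Group G] {B : Type u} [CStarAlgebra B]
  {H : Type w} [NormedAddCommGroup H] [InnerProductSpace ℂ H]

/-! ### Operators on `ℓ²(G, H)` and compression to the fibre over the identity -/

theorem translationOp_apply (g : G) (ξ : ellTwo G H) (h : G) :
    translationOp H g ξ h = ξ (g⁻¹ * h) := rfl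

theorem translationOp_one : translationOp H (1 : G) = 1 := by
  ext ξ h
  simp [translationOp_apply]

theorem translationOp_mul (g h : G) :
    translationOp H (g * h) = translationOp H g * translationOp H h := by
  ext ξ k
  simp [translationOp_apply, mul_assoc]

theorem star_translationOp [CompleteSpace H] (g : G) :
    star (translationOp H g) = translationOp H g⁻¹ := by
  have h1 : star (translationOp H g) * translationOp H g = 1 :=
    (ContinuousLinearMap.norm_map_iff_adjoint_comp_self _).1 (norm_leftTranslate g)
  calc star (translationOp H g)
      = star (translationOp H g) * (translationOp H g * translationOp H g⁻¹) := by
        rw [← translationOp_mul, mul_inv_cancel, translationOp_one, mul_one]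
    _ = translationOp H g⁻¹ := by rw [← mul_assoc, h1, one_mul]

open scoped Classical

/-- The compression of an operator on `ℓ²(G, H)` to the copy of `H` over the identity of `G`. -/
noncomputable def compression (T : ellTwo G H →L[ℂ] ellTwo G H) : H →L[ℂ] H :=
  (lp.evalCLM ℂ (fun _ : G => H) 2 1).comp
    (T.comp (lp.singleContinuousLinearMap ℂ (fun _ : G => H) 2 1))

theorem compression_apply (T : ellTwo G H →L[ℂ] ellTwo G H) (h : H) :
    compression T h = T (lp.single 2 1 h) 1 := rfl

theorem compression_add (S T : ellTwo G H →L[ℂ] ellTwo G H) :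
    compression (S + T) = compression S + compression T := rfl

theorem compression_smul (c : ℂ) (T : ellTwo G H →L[ℂ] ellTwo G H) :
    compression (c • T) = c • compression T := rfl

theorem norm_compression_le (T : ellTwo G H →L[ℂ] ellTwo G H) : ‖compression T‖ ≤ ‖T‖ := by
  refine ContinuousLinearMap.opNorm_le_bound _ (norm_nonneg T) fun h => ?_
  rw [compression_apply]
  refine (lp.norm_apply_le_norm two_ne_zero _ _).trans ((T.le_opNorm _).trans_eq ?_)
  rw [lp.norm_single (by norm_num)]

variable [CompleteSpace H]

theorem coeffOp_apply (π : B →⋆ₐ[ℂ] (H →L[ℂ] H)) (α : G →* (B ≃⋆ₐ[ℂ] B)) (b : B)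
    (ξ : ellTwo G H) (h : G) : coeffOp π α b ξ h = π (α h⁻¹ b) (ξ h) := rfl

theorem translationOp_mul_coeffOp (π : B →⋆ₐ[ℂ] (H →L[ℂ] H)) (α : G →* (B ≃⋆ₐ[ℂ] B)) (g : G)
    (b : B) : translationOp H g * coeffOp π α b = coeffOp π α (α g b) * translationOp H g := by
  ext ξ h
  simp only [mul_apply_eq_comp, translationOp_apply, coeffOp_apply, mul_inv_rev,
    inv_inv, map_mul, StarAlgEquiv.mul_apply]

/-- With `V` the inclusion of the fibre over `1`, the compression is `(TV)*(TV)`. -/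
theorem compression_star_mul_self_nonneg (T : ellTwo G H →L[ℂ] ellTwo G H) :
    0 ≤ compression (star T * T) := by
  rw [ContinuousLinearMap.nonneg_iff_isPositive, ContinuousLinearMap.isPositive_iff_complex]
  intro h
  have : inner ℂ (compression (star T * T) h) h
      = inner ℂ (T (lp.single 2 1 h)) (T (lp.single 2 1 h)) := by
    rw [compression_apply, ← lp.inner_single_right, mul_apply_eq_comp,
      ContinuousLinearMap.star_eq_adjoint, ContinuousLinearMap.adjoint_inner_left]
  rw [this, inner_self_eq_norm_sq_to_K]
  norm_cast
  exact ⟨rfl, by positivity⟩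

/-- Translation by `g` moves the fibre over `1` to the fibre over `g`, and `π̃(b)` is diagonal, so
nothing returns to the fibre over `1` unless `g = 1`. -/
theorem compression_coeffOp_mul_translationOp (π : B →⋆ₐ[ℂ] (H →L[ℂ] H))
    (α : G →* (B ≃⋆ₐ[ℂ] B)) (b : B) (g : G) :
    compression (coeffOp π α b * translationOp H g) = if g = 1 then π b else 0 := by
  ext h
  rw [compression_apply, mul_apply_eq_comp, coeffOp_apply, translationOp_apply]
  split_ifs with hg
  · simp [hg]
  · rw [lp.single_apply_ne _ _ _ (by simpa using hg)]
    simp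

end ReducedCrossedProduct

/-! ### The conditional expectation of a reduced crossed product -/

namespace CrossedProductIdent

variable {G : Type v} [Group G] {B : Type u} [CStarAlgebra B] {C : Type x} [CStarAlgebra C]
  {ι : B →⋆ₐ[ℂ] C} {α : G →* (B ≃⋆ₐ[ℂ] B)} (D : CrossedProductIdent.{u, v, w, x} ι α)

/-- The representation of `C = B ⋊_{α,r} G` on `ℓ²(G, H)`. -/
noncomputable def rep : C →⋆ₐ[ℂ] (ellTwo G D.H →L[ℂ] ellTwo G D.H) :=
  (reducedCrossedProduct D.π α).subtype.comp (D.Φ : C →⋆ₐ[ℂ] reducedCrossedProduct D.π α)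

theorem rep_apply (c : C) : D.rep c = (D.Φ c : ellTwo G D.H →L[ℂ] ellTwo G D.H) := rfl

theorem rep_injective : Function.Injective D.rep :=
  Subtype.val_injective.comp D.Φ.injective

theorem rep_ι (b : B) : D.rep (ι b) = coeffOp D.π α b := D.apply_ι b

theorem rep_u (g : G) : D.rep (D.u g) = translationOp D.H g := by
  simp [rep_apply, u]

theorem u_one : D.u 1 = 1 :=
  D.rep_injective (by rw [rep_u, translationOp_one, map_one])

theorem u_mul (g h : G) : D.u (g * h) = D.u g * D.u h :=
  D.rep_injective (by rw [map_mul, rep_u, rep_u, rep_u, translationOp_mul])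

theorem star_u (g : G) : star (D.u g) = D.u g⁻¹ :=
  D.rep_injective (by rw [map_star, rep_u, rep_u, star_translationOp])

theorem u_mul_ι (g : G) (b : B) : D.u g * ι b = ι (α g b) * D.u g :=
  D.rep_injective (by simp only [map_mul, rep_u, rep_ι, translationOp_mul_coeffOp])

theorem ι_mul_u_mul_ι_mul_u (a b : B) (g h : G) :
    (ι a * D.u g) * (ι b * D.u h) = ι (a * α g b) * D.u (g * h) := by
  rw [map_mul, u_mul, mul_assoc, ← mul_assoc (D.u g), u_mul_ι]
  simp only [mul_assoc]

theorem star_ι_mul_u (a : B) (g : G) :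
    star (ι a * D.u g) = ι (α g⁻¹ (star a)) * D.u g⁻¹ := by
  rw [star_mul, star_u, ← map_star, u_mul_ι]

/-- The algebraic crossed product: the finite sums of the elements `b u_g`. -/
noncomputable def algebraic : Submodule ℂ C :=
  Submodule.span ℂ (Set.range fun p : B × G => ι p.1 * D.u p.2)

theorem ι_mul_u_mem (b : B) (g : G) : ι b * D.u g ∈ D.algebraic :=
  Submodule.subset_span ⟨(b, g), rfl⟩

theorem mul_mem_algebraic {c d : C} (hc : c ∈ D.algebraic) (hd : d ∈ D.algebraic) :
    c * d ∈ D.algebraic := by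
  refine Submodule.span_induction₂ (p := fun c d _ _ => c * d ∈ D.algebraic) ?_ ?_ ?_ ?_ ?_ ?_ ?_
    hc hd
  · rintro _ _ ⟨p, rfl⟩ ⟨q, rfl⟩
    simp only [ι_mul_u_mul_ι_mul_u]
    exact D.ι_mul_u_mem _ _
  · simp
  · simp
  · intro x y z _ _ _ h1 h2
    rw [add_mul]; exact add_mem h1 h2
  · intro x y z _ _ _ h1 h2
    rw [mul_add]; exact add_mem h1 h2
  · intro r x y _ _ h
    rw [smul_mul_assoc]; exact Submodule.smul_mem _ _ h
  · intro r x y _ _ h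
    rw [mul_smul_comm]; exact Submodule.smul_mem _ _ h

theorem star_mem_algebraic {c : C} (hc : c ∈ D.algebraic) : star c ∈ D.algebraic := by
  induction hc using Submodule.span_induction with
  | mem x h =>
    obtain ⟨p, rfl⟩ := h
    simp only [star_ι_mul_u]
    exact D.ι_mul_u_mem _ _
  | zero => simp
  | add x y _ _ h1 h2 => rw [star_add]; exact add_mem h1 h2
  | smul r x _ h => rw [star_smul]; exact Submodule.smul_mem _ _ h

theorem ι_mem (b : B) : ι b ∈ D.algebraic := by
  simpa [u_one] using D.ι_mul_u_mem b 1

theorem u_mem (g : G) : D.u g ∈ D.algebraic := by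
  simpa using D.ι_mul_u_mem 1 g

/-- The covariance relation makes the span of the `b u_g` a ⋆-subalgebra. It contains the
generators, and density transfers back to `C` because `rep` is isometric. -/
theorem dense_algebraic : Dense (D.algebraic : Set C) := by
  have key : ∀ T ∈ StarAlgebra.adjoin ℂ
      (Set.range (coeffOp D.π α) ∪ Set.range (translationOp (G := G) D.H)),
      T ∈ D.rep '' (D.algebraic : Set C) := by
    intro T hT
    induction hT using StarAlgebra.adjoin_induction with
    | mem x h =>
      rcases h with ⟨b, rfl⟩ | ⟨g, rfl⟩
      · exact ⟨ι b, D.ι_mem b, D.rep_ι b⟩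
      · exact ⟨D.u g, D.u_mem g, D.rep_u g⟩
    | algebraMap r =>
      refine ⟨algebraMap ℂ C r, ?_, AlgHomClass.commutes D.rep r⟩
      rw [← AlgHomClass.commutes ι r]
      exact D.ι_mem _
    | add x y _ _ hx hy =>
      obtain ⟨⟨c, hc, rfl⟩, ⟨d, hd, rfl⟩⟩ := And.intro hx hy
      exact ⟨c + d, add_mem hc hd, map_add _ _ _⟩
    | mul x y _ _ hx hy =>
      obtain ⟨⟨c, hc, rfl⟩, ⟨d, hd, rfl⟩⟩ := And.intro hx hy
      exact ⟨c * d, D.mul_mem_algebraic hc hd, map_mul _ _ _⟩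
    | star x _ hx =>
      obtain ⟨c, hc, rfl⟩ := hx
      exact ⟨star c, D.star_mem_algebraic hc, map_star _ _⟩
  intro c
  have hind := (NonUnitalStarAlgHom.isometry D.rep D.rep_injective).isUniformInducing.isInducing
  rw [hind.closure_eq_preimage_closure_image]
  have : D.rep c ∈ reducedCrossedProduct D.π α := (D.Φ c).2
  rw [reducedCrossedProduct, ← SetLike.mem_coe, StarSubalgebra.topologicalClosure_coe] at this
  exact closure_mono key this

/-- A faithful representation is isometric, so its range is closed and the claim need only be
checked on the dense span, where the compression of `b u_g` is `π b` or `0`. This gives the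
expectation its values in `B`. -/
theorem compression_rep_mem_range (c : C) : compression (D.rep c) ∈ Set.range D.π := by
  have hrep : Continuous D.rep := (NonUnitalStarAlgHom.isometry D.rep D.rep_injective).continuous
  have hcomp : Continuous (compression (G := G) (H := D.H)) :=
    (LinearMap.mkContinuous
      ({ toFun := compression, map_add' := compression_add, map_smul' := compression_smul } :
        (ellTwo G D.H →L[ℂ] ellTwo G D.H) →ₗ[ℂ] (D.H →L[ℂ] D.H)) 1
        fun T => by rw [one_mul]; exact norm_compression_le T).continuous
  have hclosed : IsClosed (Set.range D.π) :=
    (NonUnitalStarAlgHom.isometry D.π D.faithful).isClosedEmbedding.isClosed_range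
  refine D.dense_algebraic.induction (P := fun c => compression (D.rep c) ∈ Set.range D.π) ?_
    (hclosed.preimage (hcomp.comp hrep)) c
  intro c hc
  induction hc using Submodule.span_induction with
  | mem x h =>
    classical
    obtain ⟨p, rfl⟩ := h
    simp only [map_mul, rep_ι, rep_u, compression_coeffOp_mul_translationOp]
    split_ifs
    · exact ⟨_, rfl⟩
    · exact ⟨0, map_zero _⟩
  | zero => exact ⟨0, by rw [map_zero, map_zero]; rfl⟩
  | add x y _ _ h1 h2 =>
    obtain ⟨⟨a, ha⟩, ⟨b, hb⟩⟩ := And.intro h1 h2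
    exact ⟨a + b, by rw [map_add, map_add, compression_add, ha, hb]⟩
  | smul r x _ h =>
    obtain ⟨a, ha⟩ := h
    exact ⟨r • a, by rw [map_smul, map_smul, compression_smul, ha]⟩

theorem exists_expectation :
    ∃ E : C →L[ℂ] B, ∀ c, D.π (E c) = compression (D.rep c) := by
  choose f hf using D.compression_rep_mem_range
  refine ⟨LinearMap.mkContinuous { toFun := f, map_add' := ?_, map_smul' := ?_ } 1 ?_, hf⟩
  · intro x y
    exact D.faithful (by rw [map_add, hf, hf, hf, map_add, compression_add])
  · intro r x
    exact D.faithful (by rw [RingHom.id_apply, map_smul, hf, hf, map_smul, compression_smul])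
  · intro c
    rw [one_mul, ← NonUnitalStarAlgHom.norm_map D.π D.faithful]
    exact (congrArg norm (hf c)).trans_le
      ((norm_compression_le _).trans (NonUnitalStarAlgHom.norm_apply_le D.rep c))

/-- The canonical conditional expectation of `C = B ⋊_{α,r} G` onto `B`. -/
noncomputable def expectation : C →L[ℂ] B := D.exists_expectation.choose

theorem π_expectation (c : C) : D.π (D.expectation c) = compression (D.rep c) :=
  D.exists_expectation.choose_spec c

open scoped Classical in
theorem expectation_ι_mul_u (b : B) (g : G) :
    D.expectation (ι b * D.u g) = if g = 1 then b else 0 := by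
  apply D.faithful
  rw [π_expectation, map_mul, rep_ι, rep_u, compression_coeffOp_mul_translationOp]
  split_ifs <;> simp

theorem expectation_ι (b : B) : D.expectation (ι b) = b := by
  classical
  simpa [u_one] using D.expectation_ι_mul_u b 1

theorem isExpectation_expectation : D.IsExpectation D.expectation := by
  refine ⟨fun c => ?_, D.expectation_ι, fun b g hg => ?_⟩
  · rw [← NonUnitalStarAlgHom.norm_map D.π D.faithful, π_expectation]
    exact (norm_compression_le _).trans (NonUnitalStarAlgHom.norm_apply_le D.rep c)
  · classical
    rw [expectation_ι_mul_u, if_neg hg]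

/-- Positivity holds after applying `π`, and a faithful representation preserves the spectrum of a
self-adjoint element. The form `star b * b` is the one tested in `traceSpace`. -/
theorem expectation_star_mul_self (c : C) :
    ∃ b : B, D.expectation (star c * c) = star b * b := by
  let := CStarAlgebra.spectralOrder B
  let := CStarAlgebra.spectralOrderedRing B
  have hnonneg : 0 ≤ D.π (D.expectation (star c * c)) := by
    rw [π_expectation, map_mul, map_star]
    exact compression_star_mul_self_nonneg _
  have hsa : IsSelfAdjoint (D.expectation (star c * c)) :=
    D.faithful (by rw [map_star]; exact (IsSelfAdjoint.of_nonneg hnonneg).star_eq)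
  rw [← CStarAlgebra.nonneg_iff_eq_star_mul_self,
    StarOrderedRing.nonneg_iff_spectrum_nonneg (R := ℝ) _ hsa,
    ← hsa.map_spectrum_real D.π D.faithful]
  exact fun x hx => spectrum_nonneg_of_nonneg hnonneg hx

/-- By density and bilinearity take `c = a u_g`, `d = b u_h`. Both sides vanish unless `h = g⁻¹`; in
that case invariance under `g⁻¹` and traciality give `τ(a α_g(b)) = τ(α_{g⁻¹}(a) b) = τ(b
α_{g⁻¹}(a))`. -/
theorem apply_expectation_mul_comm {τ : B →L[ℂ] ℂ} (hτ : ∀ a b, τ (a * b) = τ (b * a))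
    (hinv : ∀ g a, τ (α g a) = τ a) (c d : C) :
    τ (D.expectation (c * d)) = τ (D.expectation (d * c)) := by
  classical
  let L : C →L[ℂ] ℂ := τ.comp D.expectation
  change L (c * d) = L (d * c)
  refine D.dense_algebraic.induction (P := fun c => L (c * d) = L (d * c)) (fun c hc => ?_)
    (isClosed_eq (by fun_prop) (by fun_prop)) c
  refine D.dense_algebraic.induction (P := fun d => L (c * d) = L (d * c)) (fun d hd => ?_)
    (isClosed_eq (by fun_prop) (by fun_prop)) d
  refine Submodule.span_induction₂ (p := fun c d _ _ => L (c * d) = L (d * c)) ?_ ?_ ?_ ?_ ?_ ?_ ?_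
    hc hd
  · rintro _ _ ⟨⟨a, g⟩, rfl⟩ ⟨⟨b, h⟩, rfl⟩
    simp only [ι_mul_u_mul_ι_mul_u, L, ContinuousLinearMap.comp_apply, expectation_ι_mul_u]
    by_cases hgh : g * h = 1
    · obtain rfl := eq_inv_of_mul_eq_one_right hgh
      simp only [mul_inv_cancel, inv_mul_cancel, if_true]
      rw [← hinv g⁻¹ (a * α g b), map_mul, ← StarAlgEquiv.mul_apply, ← map_mul]
      simpa using hτ _ _
    · rw [if_neg hgh, if_neg fun h' => hgh (mul_eq_one_comm.1 h')]
  · simp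
  · simp
  · intro x y z _ _ _ h1 h2
    rw [add_mul, mul_add, map_add, map_add, h1, h2]
  · intro x y z _ _ _ h1 h2
    rw [add_mul, mul_add, map_add, map_add, h1, h2]
  · intro r x y _ _ h
    rw [smul_mul_assoc, mul_smul_comm, map_smul, map_smul, h]
  · intro r x y _ _ h
    rw [smul_mul_assoc, mul_smul_comm, map_smul, map_smul, h]

end CrossedProductIdent

/-- Compatible contractive linear maps on a directed family of subspaces with dense union extend
to the whole space. -/
theorem exists_clm_of_directed {I : Type*} [Nonempty I] {X Y : Type*} [NormedAddCommGroup X]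
    [NormedSpace ℂ X] [NormedAddCommGroup Y] [NormedSpace ℂ Y] [CompleteSpace Y]
    {K : I → Type*} [∀ i, AddCommGroup (K i)] [∀ i, Module ℂ (K i)] (κ : ∀ i, K i →ₗ[ℂ] X)
    (hdir : Directed (· ≤ ·) fun i => LinearMap.range (κ i))
    (hdense : Dense (⋃ i, Set.range (κ i))) (f : ∀ i, K i →ₗ[ℂ] Y)
    (hf : ∀ i x, ‖f i x‖ ≤ ‖κ i x‖) (hcompat : ∀ i j x y, κ i x = κ j y → f i x = f j y) :
    ∃ F : X →L[ℂ] Y, (∀ x, ‖F x‖ ≤ ‖x‖) ∧ ∀ i x, F (κ i x) = f i x := by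
  have hmem : ∀ m : (⨆ i, LinearMap.range (κ i) : Submodule ℂ X), ∃ i, ∃ x, κ i x = m := fun m => by
    simpa using (Submodule.mem_iSup_of_directed _ hdir).1 m.2
  choose ind rep hrep using hmem
  -- By compatibility the value does not depend on the chosen representative, so linearity can be
  -- checked in a common larger subspace.
  have hval : ∀ (m : (⨆ i, LinearMap.range (κ i) : Submodule ℂ X)) i x, κ i x = (m : X) →
      f (ind m) (rep m) = f i x := fun m i x h => hcompat _ _ _ _ ((hrep m).trans h.symm)
  let g : (⨆ i, LinearMap.range (κ i) : Submodule ℂ X) →ₗ[ℂ] Y :=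
    { toFun := fun m => f (ind m) (rep m)
      map_add' := fun m n => by
        obtain ⟨k, hk1, hk2⟩ := hdir (ind m) (ind n)
        obtain ⟨x, hx⟩ := hk1 ⟨rep m, rfl⟩
        obtain ⟨y, hy⟩ := hk2 ⟨rep n, rfl⟩
        rw [hrep] at hx hy
        rw [hval m k x hx, hval n k y hy, hval (m + n) k (x + y) (by rw [map_add, hx, hy]; rfl),
          map_add]
      map_smul' := fun r m => by
        rw [hval (r • m) (ind m) (r • rep m) (by rw [map_smul, hrep]; rfl), map_smul]
        rfl }
  let e := (⨆ i, LinearMap.range (κ i) : Submodule ℂ X).subtype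
  have he : DenseRange e := by
    refine hdense.mono (Set.iUnion_subset fun i => ?_)
    rintro _ ⟨x, rfl⟩
    exact ⟨⟨κ i x, Submodule.mem_iSup_of_mem i ⟨x, rfl⟩⟩, rfl⟩
  have hg : ∀ m, ‖g m‖ ≤ 1 * ‖e m‖ := fun m => by
    rw [one_mul]
    exact (hf _ _).trans_eq (congrArg norm (hrep m))
  refine ⟨g.extendOfNorm e, fun x => ?_, fun i x => ?_⟩
  · simpa using LinearMap.norm_extendOfNorm_apply_le he 1 hg x
  · have := LinearMap.extendOfNorm_eq he ⟨1, hg⟩ ⟨κ i x, Submodule.mem_iSup_of_mem i ⟨x, rfl⟩⟩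
    exact this.trans (hval _ i x rfl)

/-! ### Transfinite composition of contractions along a tower -/

section Tower

variable {A : Type u} [CStarAlgebra A] {I : Type*} [LinearOrder I]

/-- The inclusion of star subalgebras as a continuous linear map. -/
noncomputable def towerInclusion {S T : StarSubalgebra ℂ A} (h : S ≤ T) : S →L[ℂ] T :=
  ⟨(StarSubalgebra.inclusion h).toAlgHom.toLinearMap,
    continuous_subtype_val.subtype_mk fun x => h x.2⟩

theorem dense_lower_of_isSuccLimit {S : I → StarSubalgebra ℂ A} (hmono : Monotone S) {β γ : I}
    (hβγ : β < γ) (h : (S γ : Set A) = closure (⋃ δ < γ, (S δ : Set A))) :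
    Dense {x : S γ | ∃ δ, β ≤ δ ∧ δ < γ ∧ (x : A) ∈ S δ} := by
  intro x
  rw [closure_subtype]
  refine closure_mono ?_ (h.subset x.2)
  simp only [Set.iUnion_subset_iff]
  intro δ hδ a ha
  exact ⟨⟨a, hmono hδ.le ha⟩, ⟨max β δ, le_max_left _ _, max_lt hβγ hδ,
    hmono (le_max_right _ _) ha⟩, rfl⟩

/-- Used with `X = S γ` at limit stages and with `X = A` at the end. -/
theorem exists_clm_of_tower {S : I → StarSubalgebra ℂ A} (hmono : Monotone S) {β : I}
    {J : Set I} (hJ : J.Nonempty)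
    [CompleteSpace (S β)] {X : Type*} [NormedAddCommGroup X] [NormedSpace ℂ X]
    (κ : ∀ δ : J, S δ →ₗ[ℂ] X) (j : X → A) (hj : Function.Injective j)
    (hjκ : ∀ δ x, j (κ δ x) = x) (hnorm : ∀ δ x, ‖κ δ x‖ = ‖x‖)
    (hdense : Dense {x : X | ∃ δ ∈ J, j x ∈ S δ})
    (f : ∀ δ : J, S δ →L[ℂ] S β) (hf : ∀ δ x, ‖f δ x‖ ≤ ‖x‖)
    (hcompat : ∀ (δ ε : J) (x : S δ) (y : S ε), (x : A) = y → f δ x = f ε y) :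
    ∃ F : X →L[ℂ] S β, (∀ x, ‖F x‖ ≤ ‖x‖) ∧
      ∀ (δ : J) (x : S δ) (y : X), j y = x → F y = f δ x := by
  have : Nonempty J := hJ.to_subtype
  have hκ : ∀ (δ : J) (x : S δ) (y : X), j y = x → κ δ x = y := fun δ x y h =>
    hj ((hjκ δ x).trans h.symm)
  obtain ⟨F, hF, hF'⟩ := exists_clm_of_directed κ
    (Monotone.directed_le fun δ ε h => by
      rintro _ ⟨x, rfl⟩
      exact ⟨⟨x, hmono h x.2⟩, hκ _ _ _ (hjκ δ x)⟩)
    (hdense.mono fun x hx => by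
      obtain ⟨δ, h1, h2⟩ := hx
      exact Set.mem_iUnion.2 ⟨⟨δ, h1⟩, (⟨j x, h2⟩ : S δ), hκ ⟨δ, h1⟩ ⟨j x, h2⟩ _ rfl⟩)
    (fun δ => (f δ : S δ →ₗ[ℂ] S β)) (fun δ x => by rw [hnorm]; exact hf δ x)
    (fun δ ε x y h => hcompat δ ε x y (by rw [← hjκ, h, hjκ]))
  exact ⟨F, hF, fun δ x y h => by rw [← hκ δ x y h]; exact hF' δ x⟩

theorem induction_from [SuccOrder I] [WellFoundedLT I] {β : I} {P : I → Prop} (base : P β)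
    (succ : ∀ γ, β ≤ γ → ¬ IsMax γ → P γ → P (Order.succ γ))
    (limit : ∀ γ, β < γ → Order.IsSuccLimit γ → (∀ δ, β ≤ δ → δ < γ → P δ) → P γ) (γ : I)
    (hγ : β ≤ γ) : P γ := by
  induction γ using SuccOrder.limitRecOn with
  | isMin γ h => rwa [le_antisymm (h hγ) hγ]
  | succ γ hγ' ih =>
    rcases hγ.eq_or_lt with rfl | h
    · exact base
    · have := (Order.lt_succ_iff_of_not_isMax hγ').1 h
      exact succ γ this hγ' (ih this)
  | isSuccLimit γ h ih =>
    rcases hγ.eq_or_lt with rfl | h'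
    · exact base
    · exact limit γ h' h fun δ h1 h2 => ih δ h2 h1

/-- A contraction of `S γ` onto `S β` which is the composition of the maps `E δ`, `β ≤ δ < γ`. -/
structure IsIteratedExpectation [SuccOrder I] (S : I → StarSubalgebra ℂ A)
    (E : ∀ β, S (Order.succ β) →L[ℂ] S β) {β γ : I} (F : S γ →L[ℂ] S β) : Prop where
  norm_le : ∀ x, ‖F x‖ ≤ ‖x‖
  apply_base : ∀ (b : S β) (x : S γ), (x : A) = b → F x = b
  apply_step : ∀ δ, β ≤ δ → Order.succ δ ≤ γ → ∀ (x : S (Order.succ δ)) (y z : S γ),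
    (y : A) = x → (z : A) = E δ x → F y = F z

variable [SuccOrder I] [WellFoundedLT I] {S : I → StarSubalgebra ℂ A}
  {E : ∀ β, S (Order.succ β) →L[ℂ] S β}

/-- Transfinite induction on the level `δ` at which the common element lives: at a successor,
`apply_step` replaces it by its image under `E`, one level lower; at a limit, density and continuity
suffice. This uniqueness makes independently chosen composites compatible. -/
theorem IsIteratedExpectation.congr (hmono : Monotone S)
    (hcont : ∀ γ, Order.IsSuccLimit γ → (S γ : Set A) = closure (⋃ β < γ, (S β : Set A)))
    {β γ γ' : I} {F : S γ →L[ℂ] S β} {F' : S γ' →L[ℂ] S β} (hF : IsIteratedExpectation S E F)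
    (hF' : IsIteratedExpectation S E F') (hβ : β ≤ γ) (hγ : γ ≤ γ') (x : S γ) (y : S γ')
    (hxy : (x : A) = y) : F x = F' y := by
  have key : ∀ δ, β ≤ δ → δ ≤ γ → ∀ (a : S δ) (x : S γ) (y : S γ'), (x : A) = a → (y : A) = a →
      F x = F' y := by
    refine fun δ hδ => induction_from (P := fun δ => δ ≤ γ → ∀ (a : S δ) (x : S γ) (y : S γ'),
      (x : A) = a → (y : A) = a → F x = F' y) ?_ ?_ ?_ δ hδ
    · intro _ a x y hx hy
      rw [hF.apply_base a x hx, hF'.apply_base a y hy]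
    · intro ε hε _ ih hεγ a x y hx hy
      have hε' : ε ≤ γ := (Order.le_succ ε).trans hεγ
      rw [hF.apply_step ε hε hεγ a x (towerInclusion (hmono hε') (E ε a)) hx rfl,
        hF'.apply_step ε hε (hεγ.trans hγ) a y (towerInclusion (hmono (hε'.trans hγ)) (E ε a))
          hy rfl]
      exact ih hε' (E ε a) _ _ rfl rfl
    · intro ε hε hlim ih hεγ a x y hx hy
      have hd := dense_lower_of_isSuccLimit hmono hε (hcont ε hlim)
      obtain rfl : x = towerInclusion (hmono hεγ) a := Subtype.ext hx
      obtain rfl : y = towerInclusion (hmono (hεγ.trans hγ)) a := Subtype.ext hy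
      refine hd.induction (P := fun a => F (towerInclusion (hmono hεγ) a)
        = F' (towerInclusion (hmono (hεγ.trans hγ)) a)) ?_
        (isClosed_eq (by fun_prop) (by fun_prop)) a
      rintro a ⟨ζ, h1, h2, h3⟩
      exact ih ζ h1 h2 (h2.le.trans hεγ) ⟨a, h3⟩ _ _ rfl rfl
  exact key γ hβ le_rfl x x y rfl hxy.symm

theorem IsIteratedExpectation.congr' (hmono : Monotone S)
    (hcont : ∀ γ, Order.IsSuccLimit γ → (S γ : Set A) = closure (⋃ β < γ, (S β : Set A)))
    {β γ γ' : I} {F : S γ →L[ℂ] S β} {F' : S γ' →L[ℂ] S β} (hF : IsIteratedExpectation S E F)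
    (hF' : IsIteratedExpectation S E F') (hβ : β ≤ γ) (hβ' : β ≤ γ') (x : S γ) (y : S γ')
    (hxy : (x : A) = y) : F x = F' y := by
  rcases le_total γ γ' with h | h
  · exact hF.congr hmono hcont hF' hβ h x y hxy
  · exact (hF'.congr hmono hcont hF hβ' h y x hxy.symm).symm

theorem exists_isIteratedExpectation [NoMaxOrder I] [∀ β, IsClosed (S β : Set A)] (hmono : Monotone S)
    (hcont : ∀ γ, Order.IsSuccLimit γ → (S γ : Set A) = closure (⋃ β < γ, (S β : Set A)))
    (hE : ∀ β c, ‖E β c‖ ≤ ‖c‖)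
    (hE' : ∀ β (b : S β) (x : S (Order.succ β)), (x : A) = b → E β x = b) (β γ : I) (h : β ≤ γ) :
    ∃ F : S γ →L[ℂ] S β, IsIteratedExpectation S E F := by
  refine induction_from (P := fun γ => ∃ F : S γ →L[ℂ] S β, IsIteratedExpectation S E F)
    ?_ ?_ ?_ γ h
  · exact ⟨ContinuousLinearMap.id ℂ _, fun _ => le_rfl, fun b x h => Subtype.ext h,
      fun δ hδ hδ' => absurd (Order.succ_le_iff.1 hδ') hδ.not_gt⟩
  · rintro γ hγ _ ⟨F, hF⟩
    refine ⟨F.comp (E γ), fun x => (hF.norm_le _).trans (hE γ x), fun b x hx => ?_, ?_⟩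
    · rw [ContinuousLinearMap.comp_apply, hE' γ (towerInclusion (hmono hγ) b) x hx]
      exact hF.apply_base _ _ rfl
    · intro δ hδ hδ' x y z hy hz
      rw [ContinuousLinearMap.comp_apply, ContinuousLinearMap.comp_apply]
      -- For the new step `δ = γ`, `E γ` fixes its own values. For an earlier step both elements
      -- already lie in `S γ`, so `E γ` fixes them and the property of `F` applies.
      rcases (Order.succ_le_succ_iff.1 hδ').eq_or_lt with rfl | hlt
      · obtain rfl : y = x := Subtype.ext hy
        rw [hE' δ (E δ y) z hz]
      · have hle := Order.succ_le_of_lt hlt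
        rw [hE' γ (towerInclusion (hmono hle) x) y hy,
          hE' γ (towerInclusion (hmono hlt.le) (E δ x)) z hz]
        exact hF.apply_step δ hδ hle x _ _ rfl rfl
  · intro γ hγ hlim ih
    choose f hf using fun δ : Set.Ico β γ => ih δ δ.2.1 δ.2.2
    obtain ⟨F, hF, hF'⟩ := exists_clm_of_tower (X := S γ) hmono (J := Set.Ico β γ)
      ⟨β, le_rfl, hγ⟩ (fun δ => (towerInclusion (hmono δ.2.2.le)).toLinearMap) Subtype.val
      Subtype.val_injective (fun _ _ => rfl) (fun _ _ => rfl)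
      ((dense_lower_of_isSuccLimit hmono hγ (hcont γ hlim)).mono
        fun x hx => by
          obtain ⟨δ, h1, h2, h3⟩ := hx
          exact ⟨δ, ⟨h1, h2⟩, h3⟩) f (fun δ => (hf δ).norm_le)
      (fun δ ε x y hxy => (hf δ).congr' hmono hcont (hf ε) δ.2.1 ε.2.1 x y hxy)
    refine ⟨F, hF, fun b x hx => ?_, ?_⟩
    · rw [hF' ⟨β, le_rfl, hγ⟩ b x hx]
      exact (hf _).apply_base _ _ rfl
    · intro δ hδ hδ' x y z hy hz
      -- A limit is not a successor, so the whole step takes place at a level strictly below `γ`.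
      have hlt : Order.succ δ < γ :=
        hδ'.lt_of_ne fun h => (hlim.isSuccPrelimit.succ_ne δ h)
      have hmem : Order.succ δ ∈ Set.Ico β γ := ⟨hδ.trans (Order.le_succ δ), hlt⟩
      have hle := hmono (Order.le_succ δ)
      rw [hF' ⟨_, hmem⟩ x y hy, hF' ⟨_, hmem⟩ (towerInclusion hle (E δ x)) z hz]
      exact (hf _).apply_step δ hδ le_rfl x _ _ rfl rfl

/-- The composition of all the maps `E γ`, `β ≤ γ`, on the inductive limit of the tower. -/
theorem exists_limit_expectation [NoMaxOrder I] [∀ β, IsClosed (S β : Set A)] (hmono : Monotone S)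
    (hcont : ∀ γ, Order.IsSuccLimit γ → (S γ : Set A) = closure (⋃ β < γ, (S β : Set A)))
    (hlim : closure (⋃ β, (S β : Set A)) = Set.univ)
    (hE : ∀ β c, ‖E β c‖ ≤ ‖c‖)
    (hE' : ∀ β (b : S β) (x : S (Order.succ β)), (x : A) = b → E β x = b) (β : I) :
    ∃ F : A →L[ℂ] S β, (∀ b : S β, F b = b) ∧
      ∀ γ, β ≤ γ → ∀ x : S (Order.succ γ), F x = F (E γ x) := by
  choose f hf using fun δ : Set.Ici β =>
    exists_isIteratedExpectation hmono hcont hE hE' β δ δ.2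
  obtain ⟨F, -, hF⟩ := exists_clm_of_tower (X := A) hmono (J := Set.Ici β) ⟨β, le_rfl⟩
    (fun δ => (S δ).toSubalgebra.val.toLinearMap) id Function.injective_id (fun _ _ => rfl)
    (fun _ _ => rfl) (by
      refine (dense_iff_closure_eq.2 hlim).mono (Set.iUnion_subset fun δ a ha => ?_)
      exact ⟨max β δ, le_max_left _ _, hmono (le_max_right _ _) ha⟩) f (fun δ => (hf δ).norm_le)
    (fun δ ε x y hxy => (hf δ).congr' hmono hcont (hf ε) δ.2 ε.2 x y hxy)
  refine ⟨F, fun b => ?_, fun γ hγ x => ?_⟩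
  · rw [hF ⟨β, le_rfl⟩ b b rfl]
    exact (hf _).apply_base _ _ rfl
  · have hmem : Order.succ γ ∈ Set.Ici β := hγ.trans (Order.le_succ γ)
    have hle := hmono (Order.le_succ γ)
    rw [hF ⟨_, hmem⟩ x x rfl, hF ⟨_, hmem⟩ (towerInclusion hle (E γ x)) (E γ x) rfl]
    exact (hf _).apply_step γ hγ le_rfl x _ _ rfl rfl

end Tower

/-! ### Traces along the tower -/

theorem CrossedProductIdent.comp_expectation_mem_traceSpace {G : Type v} [Group G] {B : Type u}
    [CStarAlgebra B] {C : Type x} [CStarAlgebra C] {ι : B →⋆ₐ[ℂ] C} {α : G →* (B ≃⋆ₐ[ℂ] B)}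
    (D : CrossedProductIdent.{u, v, w, x} ι α) {τ : B →L[ℂ] ℂ}
    (hτ : StrongDual.toWeakDual τ ∈ traceSpace B) (hinv : ∀ g a, τ (α g a) = τ a) :
    StrongDual.toWeakDual (τ.comp D.expectation) ∈ traceSpace C := by
  refine ⟨?_, fun c => ?_, D.apply_expectation_mul_comm hτ.2.2 hinv⟩
  · change τ (D.expectation 1) = 1
    rw [← map_one ι, D.expectation_ι]
    exact hτ.1
  · obtain ⟨b, hb⟩ := D.expectation_star_mul_self c
    change 0 ≤ τ (D.expectation (star c * c))
    rw [hb]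
    exact hτ.2.1 b

theorem mem_traceSpace_of_dense {X : Type*} [CStarAlgebra X] {τ : X →L[ℂ] ℂ} (h1 : τ 1 = 1)
    {s : Set X} (hs : Dense s) (hpos : ∀ a ∈ s, 0 ≤ τ (star a * a))
    (hcomm : ∀ a ∈ s, ∀ b ∈ s, τ (a * b) = τ (b * a)) :
    StrongDual.toWeakDual τ ∈ traceSpace X := by
  refine ⟨h1, fun a => ?_, fun a b => ?_⟩
  · exact hs.induction (P := fun a => 0 ≤ τ (star a * a)) hpos
      (isClosed_Ici.preimage (by fun_prop : Continuous fun a => τ (star a * a))) a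
  · refine hs.induction (P := fun a => τ (a * b) = τ (b * a)) (fun a ha => ?_)
      (isClosed_eq (by fun_prop) (by fun_prop)) a
    exact hs.induction (P := fun b => τ (a * b) = τ (b * a)) (hcomm a ha)
      (isClosed_eq (by fun_prop) (by fun_prop)) b

/-- The restriction of a functional on `A` to a star subalgebra. -/
noncomputable def restrictFunctional {A : Type u} [CStarAlgebra A] (φ : A →L[ℂ] ℂ)
    (S : StarSubalgebra ℂ A) : S →L[ℂ] ℂ :=
  φ.comp ⟨S.toSubalgebra.val.toLinearMap, continuous_subtype_val⟩

section Tower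

variable {A : Type u} [CStarAlgebra A] {I : Type*} [LinearOrder I]
  {S : I → StarSubalgebra ℂ A} [∀ β, IsClosed (S β : Set A)]

/-- Positivity and traciality are closed conditions, and any two elements of the dense set lie in a
common level because the levels form a chain. -/
theorem mem_traceSpace_of_tower {X : Type*} [CStarAlgebra X] (j : X →⋆ₐ[ℂ] A) (hmono : Monotone S)
    {J : Set I} (hdense : Dense {x : X | ∃ δ ∈ J, j x ∈ S δ}) (φ : A →L[ℂ] ℂ) (hφ : φ 1 = 1)
    (h : ∀ δ ∈ J, StrongDual.toWeakDual (restrictFunctional φ (S δ)) ∈ traceSpace (S δ))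
    {τ : X →L[ℂ] ℂ} (hτ : ∀ x, τ x = φ (j x)) :
    StrongDual.toWeakDual τ ∈ traceSpace X := by
  refine mem_traceSpace_of_dense (by rw [hτ, map_one, hφ]) hdense ?_ ?_
  · rintro a ⟨δ, hδ, ha⟩
    rw [hτ, map_mul, map_star]
    exact (h δ hδ).2.1 ⟨j a, ha⟩
  · rintro a ⟨δ, hδ, ha⟩ b ⟨ε, hε, hb⟩
    rw [hτ, hτ, map_mul j, map_mul j]
    rcases le_total δ ε with hle | hle
    · exact (h ε hε).2.2 ⟨j a, hmono hle ha⟩ ⟨j b, hb⟩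
    · exact (h δ hδ).2.2 ⟨j a, ha⟩ ⟨j b, hmono hle hb⟩

variable [SuccOrder I] [WellFoundedLT I]

theorem comp_limit_expectation_mem_traceSpace (hmono : Monotone S)
    (hcont : ∀ γ, Order.IsSuccLimit γ → (S γ : Set A) = closure (⋃ β < γ, (S β : Set A)))
    (hlim : closure (⋃ β, (S β : Set A)) = Set.univ)
    (G : I → Type v) [∀ β, Group (G β)] (α : ∀ β, G β →* (S β ≃⋆ₐ[ℂ] S β))
    (D : ∀ β, CrossedProductIdent.{u, v, w, u}
      (StarSubalgebra.inclusion (hmono (Order.le_succ β))) (α β))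
    (hinv : ∀ β, ∀ τ ∈ traceSpace (S β), ∀ (g : G β) (a : S β), τ (α β g a) = τ a)
    {β : I} {F : A →L[ℂ] S β} (hF : ∀ b : S β, F b = b)
    (hF' : ∀ γ, β ≤ γ → ∀ x : S (Order.succ γ), F x = F ((D γ).expectation x))
    {τ : S β →L[ℂ] ℂ} (hτ : StrongDual.toWeakDual τ ∈ traceSpace (S β)) :
    StrongDual.toWeakDual (τ.comp F) ∈ traceSpace A := by
  have h1 : (τ.comp F) 1 = 1 := by
    have : F 1 = 1 := hF 1
    rw [ContinuousLinearMap.comp_apply, this]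
    exact hτ.1
  have key : ∀ γ, β ≤ γ →
      StrongDual.toWeakDual (restrictFunctional (τ.comp F) (S γ)) ∈ traceSpace (S γ) := by
    refine fun γ hγ => induction_from (P := fun γ =>
      StrongDual.toWeakDual (restrictFunctional (τ.comp F) (S γ)) ∈ traceSpace (S γ)) ?_ ?_ ?_ γ hγ
    · convert! hτ
      ext x
      exact congrArg τ (hF x)
    -- Invariance is applied to the trace just obtained on `S γ`, not only to `τ`; hence the need
    -- for all traces at every level to be invariant.
    · intro γ hγ _ ih
      convert! (D γ).comp_expectation_mem_traceSpace ih (hinv γ _ ih)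
      ext x
      exact congrArg τ (hF' γ hγ x)
    · intro γ hγ hlim' ih
      exact mem_traceSpace_of_tower (S γ).subtype hmono (J := Set.Ico β γ)
        ((dense_lower_of_isSuccLimit hmono hγ (hcont γ hlim')).mono
          fun x hx => by
            obtain ⟨δ, h1, h2, h3⟩ := hx
            exact ⟨δ, ⟨h1, h2⟩, h3⟩) (τ.comp F) h1
        (fun δ hδ => ih δ hδ.1 hδ.2) fun _ => rfl
  refine mem_traceSpace_of_tower (StarAlgHom.id ℂ A) hmono (J := Set.Ici β) ?_ (τ.comp F) h1
    key fun _ => rfl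
  refine (dense_iff_closure_eq.2 hlim).mono (Set.iUnion_subset fun δ a ha => ?_)
  exact ⟨max β δ, le_max_left _ _, hmono (le_max_right _ _) ha⟩

end Tower

/-! ### The embeddings of trace spaces -/

theorem mainTheorem6 {A : Type u} [CStarAlgebra A]
    -- an increasing sequence, indexed by the countable ordinals, of unital C⋆-subalgebras
    (S : Set.Iio (ω₁ : Ordinal.{0}) → StarSubalgebra ℂ A)
    [∀ β, IsClosed (S β : Set A)]
    (hmono : Monotone S)
    -- it is continuous
    (hcont : ∀ γ, Order.IsSuccLimit γ → (S γ : Set A) = closure (⋃ β < γ, (S β : Set A)))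
    -- `A` is its inductive limit
    (hlim : closure (⋃ β, (S β : Set A)) = Set.univ)
    -- the successors are reduced crossed products by discrete groups
    (G : Set.Iio (ω₁ : Ordinal.{0}) → Type v) [∀ β, Group (G β)]
    (α : ∀ β, G β →* (S β ≃⋆ₐ[ℂ] S β))
    (D : ∀ β, CrossedProductIdent.{u, v, w, u}
      (StarSubalgebra.inclusion (hmono (Order.le_succ β))) (α β))
    -- all traces are invariant
    (hinv : ∀ β, ∀ τ ∈ traceSpace (S β), ∀ (g : G β) (a : S β), τ (α β g a) = τ a) :
    ∃ E : ∀ β, S (Order.succ β) →L[ℂ] S β, (∀ β, (D β).IsExpectation (E β)) ∧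
      ∀ β, ∃ e : traceSpace (S β) → traceSpace A, Topology.IsEmbedding e ∧
        ∀ τ : traceSpace (S β),
          (∀ a : S β, (e τ).1 (a : A) = τ.1 a) ∧
          ∀ γ, β ≤ γ → ∀ x : S (Order.succ γ), (e τ).1 (x : A) = (e τ).1 (E γ x : A) := by
  -- Since `ω₁` is a limit ordinal, `Order.succ` is strictly increasing at every index.
  have : NoMaxOrder (Set.Iio (ω₁ : Ordinal.{0})) :=
    (Cardinal.isSuccLimit_omega 1).isSuccPrelimit.noMaxOrder_Iio
  refine ⟨fun β => (D β).expectation, fun β => (D β).isExpectation_expectation, fun β => ?_⟩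
  obtain ⟨F, hF, hF'⟩ := exists_limit_expectation (E := fun β => (D β).expectation) hmono hcont
    hlim (fun β => (D β).isExpectation_expectation.1)
    (fun β b x hx => by
      obtain rfl : x = StarSubalgebra.inclusion (hmono (Order.le_succ β)) b := Subtype.ext hx
      exact (D β).expectation_ι b) β
  let e : traceSpace (S β) → traceSpace A := fun τ =>
    ⟨StrongDual.toWeakDual ((WeakDual.toStrongDual τ.1).comp F),
      comp_limit_expectation_mem_traceSpace hmono hcont hlim G α D hinv hF hF' τ.2⟩
  have he : ∀ τ a, (e τ).1 a = τ.1 (F a) := fun _ _ => rfl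
  refine ⟨e, ?_, fun τ => ⟨fun a => by rw [he, hF], fun γ hγ x => ?_⟩⟩
  · have hcont_e : Continuous e := by
      refine Continuous.subtype_mk (WeakDual.continuous_of_continuous_eval fun a => ?_) _
      exact (WeakDual.eval_continuous (F a)).comp continuous_subtype_val
    -- Restriction to `S β` is weak-⋆ continuous and, as `F` fixes `S β`, its composite with `e` is
    -- the inclusion of `traceSpace (S β)` in the dual. This forces `e` to be an embedding.
    let r : WeakDual ℂ A → WeakDual ℂ (S β) := fun φ =>
      StrongDual.toWeakDual (restrictFunctional (WeakDual.toStrongDual φ) (S β))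
    have hr : Continuous fun φ : traceSpace A => r φ.1 :=
      WeakDual.continuous_of_continuous_eval fun a =>
        (WeakDual.eval_continuous (a : A)).comp continuous_subtype_val
    refine Topology.IsEmbedding.of_comp hcont_e hr ?_
    convert! Topology.IsEmbedding.subtypeVal using 1
    funext τ
    exact DFunLike.ext _ _ fun a => congrArg τ.1 (hF a)
  · rw [he, he]
    exact congrArg τ.1 (hF' γ hγ x)
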